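/- Let $\mathcal L$ be a closed subspace of the real Hilbert space $L^2[0,1]$ and let $F:\mathcal L\times\mathcal L\to\mathbb R$ be a bounded bilinear mapping (bounded: $|F(u,v)|\le C\|u\|\,\|v\|$ for some finite $C$). Let $L\in\{0,1,2,\dots\}\cup\{\infty\}$ be the (Hilbert) dimension of $\mathcal L$, let $(e_i)_{1\le i\le L}$ and $(f_j)_{1\le j\le L}$ (indices running over all positive integers if $L=\infty$) be orthonormal bases of $\mathcal L$, and let $\mathbf F=[F(e_i,f_j)]$ be the corresponding $L\times L$ matrix representation of $F$. For a positive integer $l\le L$ let $\mathbf F_l$ be the $l\times l$ leading principal block of $\mathbf F$. Let $s\in\{0,1,2,\dots\}\cup\{\infty\}$ be the rank of $\mathbf F$, i.e. its number of linearly independent columns ($\infty$ if no finitely many columns span all of them). Call $\mathbf F$ regular if $\mathbf F_j$ is nonsingular for every positive integer $j\le s$. Call $\mathbf F$ strongly regular if either $L<\infty$ and $\mathbf F$ is regular, or $L=\infty$, $\mathbf F$ is diagonal and $\mathbf F_{j,j}\ge \mathbf F_{j+1,j+1}>0$ for all positive integers $j$. For a finite matrix $\mathbf M$ let $\sigma_1(\mathbf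 M)\ge\sigma_2(\mathbf M)\ge\cdots$ be its singular values. For $\mathbf F$, let $\sigma_k(\mathbf F)$ be the $k$-th largest singular value of $\mathbf F$ if $L<\infty$, and $\sigma_k(\mathbf F)=\lim_{l\to\infty}\sigma_k(\mathbf F_l)$ if $L=\infty$. Let $m,n\ge1$ be integers and let $\mathbf H=[\mathbf H_{ij}]$ be a real $m\times n$ matrix. A single-round protocol realizing $\mathbf H$ is a choice of controls $u_1,\dots,u_m\in\mathcal L$ and $v_1,\dots,v_n\in\mathcal L$ with $F(u_i,v_j)=\mathbf H_{ij}$ for all $i,j$; its control cost is $$I=\frac1m\sum_{i=1}^m\int_0^1u_i^2(t)\,dt+\frac1n\sum_{j=1}^n\int_0^1v_j^2(t)\,dt .$$ Theorem. Suppose that $\mathbf F$ is regular and $s\ge\max(m,n)$. Then single-round protocols realizing $\mathbf H$ exist, and the infimum of their control costs is $$\hat C_F(\mathbf H)=\frac{2}{\sqrt{mn}}\sum_{k=1}^{\min(m,n)}\frac{\sigma_k(\mathbf H)}{\sigma_k(\mathbf F)} .$$ If moreover $\mathbf F$ is strongly regular, then some single-round protocol realizing $\mathbf H$ has control cost equal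 to this infimum. -/

import Mathlib

open MeasureTheory Filter Topology

noncomputable section

namespace BilinearControl

/-- The real Hilbert space `L²[0,1]` of square integrable scalar control functions. -/
abbrev L2Controls : Type := Lp ℝ 2 (volume.restrict (Set.Icc (0 : ℝ) 1))

/-- The labels of an orthonormal basis with `L` elements, where `L` is a natural number or `∞`.
Labels start at `0`, so the label `k` stands for the `(k+1)`-st basis element. -/
abbrev BasisIndex (L : ℕ∞) : Type := {k : ℕ // (k : ℕ∞) < L}

/-- A single round protocol with controls in `𝓛`, for a first agent with `m` choices and a second
agent with `n` choices. There is no communication: the control of each agent depends on the choice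
of that agent only. -/
structure SingleRoundProtocol (𝓛 : Submodule ℝ L2Controls) (m n : ℕ) where
  /-- the control used by the first agent, for each of her choices -/
  u : Fin m → 𝓛
  /-- the control used by the second agent, for each of his choices -/
  v : Fin n → 𝓛

namespace SingleRoundProtocol

variable {𝓛 : Submodule ℝ L2Controls} {m n : ℕ}

/-- The protocol realizes the target matrix `H` for the input-output mapping `F`. -/
def Realizes (P : SingleRoundProtocol 𝓛 m n) (F : 𝓛 →L[ℝ] 𝓛 →L[ℝ] ℝ)
    (H : Matrix (Fin m) (Fin n) ℝ) : Prop :=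
  ∀ i j, F (P.u i) (P.v j) = H i j

/-- The control cost: the average control energy over all choices of the two agents. -/
def cost (P : SingleRoundProtocol 𝓛 m n) : ℝ :=
  1 / (m : ℝ) * ∑ i, ∫ t in Set.Icc (0 : ℝ) 1, ((P.u i : L2Controls) t) ^ 2 +
    1 / (n : ℝ) * ∑ j, ∫ t in Set.Icc (0 : ℝ) 1, ((P.v j : L2Controls) t) ^ 2

end SingleRoundProtocol

/-- The matrix representation `[F(e_i, f_j)]` of a bounded bilinear mapping with respect to a pair
of orthonormal (Hilbert) bases. -/
def matrixRep {𝓛 : Submodule ℝ L2Controls} {L : ℕ∞} (F : 𝓛 →L[ℝ] 𝓛 →L[ℝ] ℝ)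
    (e f : HilbertBasis (BasisIndex L) ℝ 𝓛) : Matrix (BasisIndex L) (BasisIndex L) ℝ :=
  Matrix.of fun i j => F (e i) (f j)

variable {L : ℕ∞}

open Classical in
/-- The entry of `A` in row `i` and column `j`; it is `0` when `A` has no such row or column. -/
def entry (A : Matrix (BasisIndex L) (BasisIndex L) ℝ) (i j : ℕ) : ℝ :=
  if h : (i : ℕ∞) < L ∧ (j : ℕ∞) < L then A ⟨i, h.1⟩ ⟨j, h.2⟩ else 0

/-- The `l`-by-`l` leading principal block of `A`, meaningful for `l ≤ L`. -/
def leadingBlock (A : Matrix (BasisIndex L) (BasisIndex L) ℝ) (l : ℕ) :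
    Matrix (Fin l) (Fin l) ℝ :=
  Matrix.of fun i j => entry A i j

/-- `A` is regular: for every positive integer `j` that is at most the rank of `A`, the
`j`-dimensional leading principal block is nonsingular. (`Matrix.eRank` is the number of
independent columns, `⊤` if no finitely many columns span all of them.) -/
def IsRegular (A : Matrix (BasisIndex L) (BasisIndex L) ℝ) : Prop :=
  ∀ j : ℕ, 1 ≤ j → (j : ℕ∞) ≤ A.eRank → (leadingBlock A j).det ≠ 0

/-- `A` is strongly regular: it is finite dimensional and regular, or it is diagonal with
infinitely many diagonal entries, all positive, in nonincreasing order. -/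
def IsStronglyRegular (A : Matrix (BasisIndex L) (BasisIndex L) ℝ) : Prop :=
  (L ≠ ⊤ ∧ IsRegular A) ∨
    (L = ⊤ ∧ A.IsDiag ∧ ∀ j : ℕ, 0 < entry A (j + 1) (j + 1) ∧
      entry A (j + 1) (j + 1) ≤ entry A j j)

/-- The `(k+1)`-st largest singular value of a finite real matrix. -/
def singularValue {p q : ℕ} (M : Matrix (Fin p) (Fin q) ℝ) (k : ℕ) : ℝ :=
  (Matrix.toLpLin 2 2 M).singularValues k

open Classical in
/-- The `(k+1)`-st largest singular value of a matrix representation: the usual one if it is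
finite dimensional (the leading block of size `L` is then the whole matrix), and the limit of the
`(k+1)`-st largest singular values of the leading principal blocks if it is infinite
dimensional. -/
def repSingularValue (A : Matrix (BasisIndex L) (BasisIndex L) ℝ) (k : ℕ) : ℝ :=
  if L = ⊤ then limUnder atTop (fun l : ℕ => singularValue (leadingBlock A l) k)
  else singularValue (leadingBlock A L.toNat) k

end BilinearControl

end

/-! ### Singular value decomposition and the lower min-max bound -/

section SingularValueDecomposition

open Module InnerProductSpace

variable {E E' : Type*} [NormedAddCommGroup E] [InnerProductSpace ℝ E] [FiniteDimensional ℝ E]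
  [NormedAddCommGroup E'] [InnerProductSpace ℝ E'] [FiniteDimensional ℝ E']

/-! Lower bound. Rotating the controls by the singular vectors of `H` keeps both total energies and
yields controls `U a`, `W b` with `F (U a) (W b) = δ_ab σ_b(H)`. By AM-GM the cost is at least
`2/√(mn) ∑ ‖U k‖‖W k‖`. It remains to see that `∑ ‖U k‖‖W k‖ ≥ ∑ σ_k(H)/σ_k(F)`. Since `σ_k(H)` is
nonincreasing, Abel summation (`sum_mul_nonneg_of_antitone`) reduces this to the partial sums
`∑_{k≤r} ‖U k‖‖W k‖/σ_k(H) ≥ ∑_{k≤r} 1/σ_k(F)` with `σ_r(H) > 0`. There `U k` and `W k/σ_k(H)` are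
dual systems for `F`. Compressing `F` to their spans gives singular values `b k`; the trace of the
inverse, `∑ 1/b k`, is at most the sum of the norm products (`exists_sum_inv_le_of_dual`), and `b k
≤ σ_k(F)` by min-max (`le_repSingularValue`).

Attainment. On orthonormal systems that diagonalize `F` with positive entries `b k`, suitably
weighted controls give equality in AM-GM and cost `2/√(mn) ∑ σ_k(H)/b k`
(`exists_controls_of_diagonal`). The singular vectors of a leading block are such systems: the whole
matrix gives the exact value if `L < ∞`, and blocks of growing size approach it if `L = ∞`. If `F`
is diagonal with positive nonincreasing entries, the basis vectors themselves attain it. Regularity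
serves to make the needed `σ_k(F)` positive. -/

theorem LinearMap.exists_rightSingularBasis (T : E →ₗ[ℝ] E') {q : ℕ} (hq : finrank ℝ E = q) :
    ∃ v : OrthonormalBasis (Fin q) ℝ E, ∀ i j,
      ⟪T (v i), T (v j)⟫_ℝ = if i = j then T.singularValues j ^ 2 else 0 := by
  refine ⟨T.isSymmetric_adjoint_comp_self.eigenvectorBasis hq, fun i j => ?_⟩
  rw [← LinearMap.adjoint_inner_right, ← LinearMap.comp_apply,
    T.isSymmetric_adjoint_comp_self.apply_eigenvectorBasis hq, inner_smul_right,
    orthonormal_iff_ite.mp (OrthonormalBasis.orthonormal _), T.sq_singularValues_fin hq]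
  simp

/-- Singular value decomposition, in terms of matrix coefficients. -/
theorem LinearMap.exists_singularBases (T : E →ₗ[ℝ] E') {p q : ℕ} (hp : finrank ℝ E' = p)
    (hq : finrank ℝ E = q) :
    ∃ (u : OrthonormalBasis (Fin p) ℝ E') (v : OrthonormalBasis (Fin q) ℝ E),
      ∀ i j, ⟪u i, T (v j)⟫_ℝ = if (i : ℕ) = j then T.singularValues j else 0 := by
  obtain ⟨v, hv⟩ := T.exists_rightSingularBasis hq
  have hzero : ∀ j : Fin q, T.singularValues j = 0 → T (v j) = 0 := fun j hj => by
    have := hv j j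
    simpa [hj] using this
  -- The left singular vectors are the normalized images `T v_i / σ_i`. They are orthonormal where
  -- `σ_i ≠ 0` and extend arbitrarily to a basis, because `T v_j = 0` whenever `σ_j = 0`.
  let w : Fin p → E' := fun i =>
    if h : (i : ℕ) < q then (T.singularValues i)⁻¹ • T (v ⟨i, h⟩) else 0
  let s : Set (Fin p) := {i | T.singularValues i ≠ 0}
  have hsq : ∀ i ∈ s, (i : ℕ) < q := fun i hi => by
    by_contra h
    exact hi (T.singularValues_of_finrank_le (by omega))
  have hw : Orthonormal ℝ (s.domRestrict w) := by
    rw [orthonormal_iff_ite]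
    rintro ⟨i, hi⟩ ⟨j, hj⟩
    have hi' := hsq i hi
    have hj' := hsq j hj
    simp only [Set.domRestrict_apply, w, hi', hj', dif_pos, inner_smul_left, inner_smul_right, hv,
      Subtype.mk.injEq, Fin.ext_iff]
    split_ifs with h
    · have hi2 : T.singularValues i ≠ 0 := hi
      rw [← h]
      simp
      field_simp
    · simp
  obtain ⟨u, hu⟩ := hw.exists_orthonormalBasis_extension_of_card_eq (by simpa using hp)
  refine ⟨u, v, fun i j => ?_⟩
  by_cases hj : T.singularValues j = 0
  · rw [hzero j hj, hj]
    simp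
  have hjp : (j : ℕ) < p := by
    have h1 := T.singularValues_pos_iff_lt_finrank_range.mp
      ((T.singularValues_pos_iff_ne_zero _).mpr hj)
    have h2 := Submodule.finrank_le (LinearMap.range T)
    omega
  have h1 : u ⟨j, hjp⟩ = (T.singularValues j)⁻¹ • T (v j) := by
    rw [hu ⟨j, hjp⟩ hj]
    simp [w]
  have h2 : T (v j) = T.singularValues j • u ⟨j, hjp⟩ := by
    rw [h1, smul_smul, mul_inv_cancel₀ hj, one_smul]
  rw [h2, inner_smul_right, orthonormal_iff_ite.mp u.orthonormal]
  simp [Fin.ext_iff]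

/-- One half of Courant-Fischer. By dimension count some `a ≠ 0` has `g a` orthogonal to the first
`k` right singular vectors, and `T` stretches such a vector by at most `σ_k`. -/
theorem LinearMap.le_singularValues_of_le_norm (T : E →ₗ[ℝ] E') {k : ℕ} {c : ℝ}
    (g : EuclideanSpace ℝ (Fin (k + 1)) →ₗ[ℝ] E) (hg : ∀ a, ‖g a‖ ≤ ‖a‖)
    (hT : ∀ a, c * ‖a‖ ≤ ‖T (g a)‖) : c ≤ T.singularValues k := by
  obtain ⟨v, hv⟩ := T.exists_rightSingularBasis rfl
  let φ : EuclideanSpace ℝ (Fin (k + 1)) →ₗ[ℝ] (Fin k → ℝ) :=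
    LinearMap.pi fun j => if h : (j : ℕ) < finrank ℝ E then
      (innerₛₗ ℝ (v ⟨j, h⟩)) ∘ₗ g else 0
  obtain ⟨a, ha, ha0⟩ : ∃ a, φ a = 0 ∧ a ≠ 0 := by
    have := LinearMap.ker_ne_bot_of_finrank_lt (f := φ) (by simp)
    obtain ⟨a, h1, h2⟩ := (Submodule.ne_bot_iff _).mp this
    exact ⟨a, h1, h2⟩
  have hz : ∀ j : Fin (finrank ℝ E), (j : ℕ) < k → ⟪v j, g a⟫_ℝ = 0 := fun j hj => by
    have := congrFun ha ⟨j, hj⟩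
    simpa [φ] using this
  have hnorm : ‖T (g a)‖ ^ 2 =
      ∑ j : Fin (finrank ℝ E), T.singularValues j ^ 2 * ⟪v j, g a⟫_ℝ ^ 2 := by
    rw [← real_inner_self_eq_norm_sq]
    conv_lhs => rw [← v.sum_repr' (g a)]
    simp only [map_sum, map_smul, sum_inner, inner_sum, inner_smul_left, inner_smul_right, hv]
    refine Finset.sum_congr rfl fun j _ => ?_
    simp
    ring
  have hle : ‖T (g a)‖ ^ 2 ≤ T.singularValues k ^ 2 * ‖g a‖ ^ 2 := by
    rw [hnorm, ← v.sum_sq_inner_right (g a), Finset.mul_sum]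
    refine Finset.sum_le_sum fun j _ => ?_
    rcases lt_or_ge (j : ℕ) k with h | h
    · simp [hz j h]
    · have := T.singularValues_antitone h
      have := T.singularValues_nonneg j
      gcongr
  have hpos : 0 < ‖a‖ := norm_pos_iff.mpr ha0
  have h1 : ‖T (g a)‖ ≤ T.singularValues k * ‖g a‖ := by
    refine le_of_sq_le_sq ?_ (mul_nonneg (T.singularValues_nonneg k) (norm_nonneg _))
    rwa [mul_pow]
  have h2 : T.singularValues k * ‖g a‖ ≤ T.singularValues k * ‖a‖ :=
    mul_le_mul_of_nonneg_left (hg a) (T.singularValues_nonneg k)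
  exact le_of_mul_le_mul_right (((hT a).trans h1).trans h2) hpos

end SingularValueDecomposition

/-! ### Compression of a bilinear form to finite-dimensional subspaces -/

section CompressionOfBilinearMap

open Module InnerProductSpace

variable {V : Type*} [NormedAddCommGroup V] [InnerProductSpace ℝ V]

/-- A bilinear form restricted to two `r`-dimensional subspaces is diagonal in suitable
orthonormal bases of these. -/
theorem exists_orthonormal_diagonalizing (F : V →L[ℝ] V →L[ℝ] ℝ) {r : ℕ} (X Y : Submodule ℝ V)
    [FiniteDimensional ℝ X] [FiniteDimensional ℝ Y] (hX : finrank ℝ X = r)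
    (hY : finrank ℝ Y = r) :
    ∃ (x : OrthonormalBasis (Fin r) ℝ X) (y : OrthonormalBasis (Fin r) ℝ Y) (b : ℕ → ℝ),
      Antitone b ∧ (∀ k, 0 ≤ b k) ∧
        ∀ i j, F (x i) (y j) = if i = j then b j else 0 := by
  -- Riesz representation is applied inside the finite-dimensional `X`, so `V` need not be complete.
  let G : Y →ₗ[ℝ] X := ((InnerProductSpace.toDual ℝ X).symm.toLinearEquiv.toLinearMap) ∘ₗ
      { toFun := fun y => (F.flip (y : V)).comp X.subtypeL
        map_add' := fun a b => by ext; simp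
        map_smul' := fun a b => by ext; simp }
  have hG : ∀ (x : X) (y : Y), ⟪x, G y⟫_ℝ = F x y := fun x y => by
    rw [real_inner_comm]
    simp [G]
  obtain ⟨x, y, hxy⟩ := G.exists_singularBases hX hY
  refine ⟨x, y, G.singularValues, G.singularValues_antitone, G.singularValues_nonneg,
    fun i j => ?_⟩
  rw [← hG, hxy]
  simp [Fin.ext_iff]

/-- In diagonalizing bases of the two spans, duality says that two square coordinate matrices are
inverse to each other. Multiplying them in the other order expresses `1/b k` through the coordinates
of `u` and `w`; Cauchy-Schwarz over `k` and Bessel then bound the sum. -/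
theorem exists_sum_inv_le_of_dual (F : V →L[ℝ] V →L[ℝ] ℝ) {r : ℕ} (u w : Fin r → V)
    (huw : ∀ i j, F (u i) (w j) = if i = j then 1 else 0) :
    ∃ (x y : Fin r → V) (b : ℕ → ℝ), Orthonormal ℝ x ∧ Orthonormal ℝ y ∧ Antitone b ∧
      (∀ k : Fin r, 0 < b k) ∧ (∀ i j, F (x i) (y j) = if i = j then b j else 0) ∧
      ∑ k : Fin r, (b k)⁻¹ ≤ ∑ i, ‖u i‖ * ‖w i‖ := by
  have hu : LinearIndependent ℝ u := by
    rw [Fintype.linearIndependent_iff]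
    intro g hg i
    have := congrArg (fun z => F z (w i)) hg
    simpa [huw] using this
  have hw : LinearIndependent ℝ w := by
    rw [Fintype.linearIndependent_iff]
    intro g hg i
    have := congrArg (fun z => F (u i) z) hg
    simpa [huw] using this
  have hfu := finrank_span_eq_card hu
  have hfw := finrank_span_eq_card hw
  have : FiniteDimensional ℝ (Submodule.span ℝ (Set.range u)) :=
    FiniteDimensional.span_of_finite ℝ (Set.finite_range u)
  have : FiniteDimensional ℝ (Submodule.span ℝ (Set.range w)) :=
    FiniteDimensional.span_of_finite ℝ (Set.finite_range w)
  obtain ⟨x, y, b, hb, hb0, hxy⟩ := exists_orthonormal_diagonalizing F _ _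
    (hfu.trans (Fintype.card_fin r)) (hfw.trans (Fintype.card_fin r))
  have hx : Orthonormal ℝ fun i => (x i : V) :=
    x.orthonormal.comp_linearIsometry (Submodule.subtypeₗᵢ _)
  have hy : Orthonormal ℝ fun i => (y i : V) :=
    y.orthonormal.comp_linearIsometry (Submodule.subtypeₗᵢ _)
  have hux : ∀ i, u i = ∑ k, ⟪(x k : V), u i⟫_ℝ • (x k : V) := fun i => by
    have := congrArg Subtype.val (x.sum_repr' ⟨u i, Submodule.subset_span ⟨i, rfl⟩⟩)
    simpa using this.symm
  have hwy : ∀ i, w i = ∑ k, ⟪(y k : V), w i⟫_ℝ • (y k : V) := fun i => by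
    have := congrArg Subtype.val (y.sum_repr' ⟨w i, Submodule.subset_span ⟨i, rfl⟩⟩)
    simpa using this.symm
  let S : Matrix (Fin r) (Fin r) ℝ := Matrix.of fun i k => ⟪(x k : V), u i⟫_ℝ
  let T : Matrix (Fin r) (Fin r) ℝ := Matrix.of fun k j => b k * ⟪(y k : V), w j⟫_ℝ
  have hST : S * T = 1 := by
    ext i j
    rw [Matrix.mul_apply, Matrix.one_apply, ← huw i j]
    conv_rhs => rw [hux i, hwy j]
    simp only [map_sum, map_smul, sum_apply, smul_apply, smul_eq_mul, hxy, S, T, Matrix.of_apply]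
    refine Finset.sum_congr rfl fun k _ => ?_
    simp
    ring
  -- For square matrices a right inverse is a left inverse; the diagonal of `T * S` isolates each `b
  -- k`.
  have hTS := mul_eq_one_comm.mp hST
  have hdiag : ∀ k : Fin r, b k * ∑ i, ⟪(y k : V), w i⟫_ℝ * ⟪(x k : V), u i⟫_ℝ = 1 := fun k => by
    have := congrFun (congrFun hTS k) k
    rw [Matrix.mul_apply, Matrix.one_apply_eq] at this
    rw [← this, Finset.mul_sum]
    exact Finset.sum_congr rfl fun i _ => by simp [S, T, mul_assoc]
  have hbpos : ∀ k : Fin r, 0 < b k := fun k =>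
    lt_of_le_of_ne (hb0 k) fun h => by
      have := hdiag k
      rw [← h] at this
      simp at this
  refine ⟨fun i => x i, fun i => y i, b, hx, hy, hb, hbpos, hxy, ?_⟩
  have hinv : ∀ k : Fin r, (b k)⁻¹ = ∑ i, ⟪(y k : V), w i⟫_ℝ * ⟪(x k : V), u i⟫_ℝ := fun k =>
    inv_eq_of_mul_eq_one_right (hdiag k)
  have hbessel : ∀ {z : Fin r → V} (_ : Orthonormal ℝ z) (a : V),
      √(∑ k, ⟪z k, a⟫_ℝ ^ 2) ≤ ‖a‖ := fun hz a => by
    refine Real.sqrt_le_iff.mpr ⟨norm_nonneg _, ?_⟩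
    have := hz.sum_inner_products_le (s := Finset.univ) a
    simpa using this
  simp_rw [hinv]
  rw [Finset.sum_comm]
  refine Finset.sum_le_sum fun i _ => ?_
  calc _ ≤ √(∑ k, ⟪(y k : V), w i⟫_ℝ ^ 2) * √(∑ k, ⟪(x k : V), u i⟫_ℝ ^ 2) :=
        Real.sum_mul_le_sqrt_mul_sqrt _ _ _
    _ ≤ ‖w i‖ * ‖u i‖ := by gcongr <;> apply hbessel <;> assumption
    _ = _ := mul_comm _ _

end CompressionOfBilinearMap

namespace BilinearControl

open InnerProductSpace

/-! ### Hilbert bases extended by zero, truncation and coordinates -/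

section PaddedBasis

variable {V : Type*} [NormedAddCommGroup V] [InnerProductSpace ℝ V] {L : ℕ∞}

open Classical in
/-- A Hilbert basis indexed by an initial segment of `ℕ`, extended by zero to all of `ℕ`. -/
noncomputable def paddedBasis (b : HilbertBasis (BasisIndex L) ℝ V) (i : ℕ) : V :=
  if h : (i : ℕ∞) < L then b ⟨i, h⟩ else 0

theorem paddedBasis_of_lt (b : HilbertBasis (BasisIndex L) ℝ V) {i : ℕ} (h : (i : ℕ∞) < L) :
    paddedBasis b i = b ⟨i, h⟩ := dif_pos h

theorem paddedBasis_of_not_lt (b : HilbertBasis (BasisIndex L) ℝ V) {i : ℕ}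
    (h : ¬ (i : ℕ∞) < L) : paddedBasis b i = 0 := dif_neg h

theorem inner_paddedBasis (b : HilbertBasis (BasisIndex L) ℝ V) {i j : ℕ} (h : (i : ℕ∞) < L) :
    ⟪paddedBasis b i, paddedBasis b j⟫_ℝ = if i = j then 1 else 0 := by
  rw [paddedBasis_of_lt b h]
  by_cases hj : (j : ℕ∞) < L
  · rw [paddedBasis_of_lt b hj, orthonormal_iff_ite.mp b.orthonormal]
    simp
  · rw [paddedBasis_of_not_lt b hj, inner_zero_right, if_neg]
    rintro rfl
    exact hj h

theorem orthonormal_paddedBasis (b : HilbertBasis (BasisIndex L) ℝ V) {l : ℕ} (hl : (l : ℕ∞) ≤ L) :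
    Orthonormal ℝ fun i : Fin l => paddedBasis b i := by
  rw [orthonormal_iff_ite]
  intro i j
  rw [inner_paddedBasis b (lt_of_lt_of_le (by exact_mod_cast i.2) hl)]
  simp [Fin.ext_iff]

theorem hasSum_paddedBasis (b : HilbertBasis (BasisIndex L) ℝ V) (x : V) :
    HasSum (fun i : ℕ => ⟪paddedBasis b i, x⟫_ℝ • paddedBasis b i) x := by
  rw [← Function.Injective.hasSum_iff (Subtype.val_injective (p := fun k : ℕ => (k : ℕ∞) < L))]
  · convert b.hasSum_repr x using 2 with i
    rw [Function.comp_apply, paddedBasis_of_lt b i.2, b.repr_apply_apply]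
  · intro i hi
    rw [paddedBasis_of_not_lt b (fun h => hi ⟨⟨i, h⟩, rfl⟩), smul_zero]

/-- The orthogonal projection to the span of the first `l` basis vectors. -/
noncomputable def truncation (b : HilbertBasis (BasisIndex L) ℝ V) (l : ℕ) (x : V) : V :=
  ∑ i : Fin l, ⟪paddedBasis b i, x⟫_ℝ • paddedBasis b i

theorem tendsto_truncation (b : HilbertBasis (BasisIndex L) ℝ V) (x : V) :
    Tendsto (fun l => truncation b l x) atTop (𝓝 x) := by
  refine (hasSum_paddedBasis b x).tendsto_sum_nat.congr fun l => ?_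
  rw [truncation, Finset.sum_range]

theorem truncation_eq_self (b : HilbertBasis (BasisIndex L) ℝ V) {l : ℕ} (hl : L ≤ l) (x : V) :
    truncation b l x = x := by
  rw [truncation, ← Finset.sum_range fun i => ⟪paddedBasis b i, x⟫_ℝ • paddedBasis b i]
  refine (hasSum_sum_of_ne_finset_zero fun i hi => ?_).unique (hasSum_paddedBasis b x)
  rw [paddedBasis_of_not_lt b, smul_zero]
  intro h
  exact hi (Finset.mem_range.mpr (by exact_mod_cast lt_of_lt_of_le h hl))

/-- The first `l` coordinates with respect to a Hilbert basis. -/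
noncomputable def coordinates (b : HilbertBasis (BasisIndex L) ℝ V) (l : ℕ) :
    V →ₗ[ℝ] EuclideanSpace ℝ (Fin l) :=
  (WithLp.linearEquiv 2 ℝ (Fin l → ℝ)).symm.toLinearMap ∘ₗ
    LinearMap.pi fun i : Fin l => innerₛₗ ℝ (paddedBasis b i)

theorem coordinates_apply (b : HilbertBasis (BasisIndex L) ℝ V) (l : ℕ) (x : V) (i : Fin l) :
    coordinates b l x i = ⟪paddedBasis b i, x⟫_ℝ := rfl

theorem norm_coordinates_le (b : HilbertBasis (BasisIndex L) ℝ V) (l : ℕ) (x : V) :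
    ‖coordinates b l x‖ ≤ ‖x‖ := by
  refine le_of_sq_le_sq ?_ (norm_nonneg x)
  rw [EuclideanSpace.norm_sq_eq]
  simp only [coordinates_apply, Real.norm_eq_abs, sq_abs]
  -- For `l > L` the padding vectors vanish, so Bessel applies only to the indices below `L`.
  let s : Finset (Fin l) := {i | ((i : ℕ) : ℕ∞) < L}
  have hs : Orthonormal ℝ fun i : s => paddedBasis b (i : Fin l) := by
    rw [orthonormal_iff_ite]
    rintro ⟨i, hi⟩ ⟨j, hj⟩
    rw [inner_paddedBasis b (Finset.mem_filter.mp hi).2]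
    simp [Fin.ext_iff]
  have h1 := hs.sum_inner_products_le (s := Finset.univ) x
  simp only [Real.norm_eq_abs, sq_abs] at h1
  rw [Finset.sum_coe_sort s (fun i : Fin l => ⟪paddedBasis b i, x⟫_ℝ ^ 2)] at h1
  refine le_trans (le_of_eq ?_) h1
  symm
  refine Finset.sum_subset (Finset.subset_univ _) fun i _ hi => ?_
  rw [paddedBasis_of_not_lt b (fun h => hi (Finset.mem_filter.mpr ⟨Finset.mem_univ _, h⟩))]
  simp

theorem sum_coordinates_smul (b : HilbertBasis (BasisIndex L) ℝ V) (l : ℕ) {ι : Type*} [Fintype ι]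
    (a : ι → ℝ) (z : ι → V) :
    ∑ i, coordinates b l (∑ j, a j • z j) i • paddedBasis b i =
      ∑ j, a j • truncation b l (z j) := by
  simp only [coordinates_apply, truncation, inner_sum, real_inner_smul_right, Finset.sum_smul,
    Finset.smul_sum, smul_smul]
  rw [Finset.sum_comm]

end PaddedBasis

theorem tendsto_bilinear_apply {V : Type*} [NormedAddCommGroup V] [InnerProductSpace ℝ V]
    (F : V →L[ℝ] V →L[ℝ] ℝ) {a b : ℕ → V} {x y : V} (ha : Tendsto a atTop (𝓝 x))
    (hb : Tendsto b atTop (𝓝 y)) : Tendsto (fun l => F (a l) (b l)) atTop (𝓝 (F x y)) := by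
  have hF : Continuous fun p : V × V => F p.1 p.2 :=
    (F.continuous.comp continuous_fst).clm_apply continuous_snd
  exact (hF.tendsto (x, y)).comp (ha.prodMk_nhds hb)

theorem exists_bilinear_bound {V : Type*} [NormedAddCommGroup V] [InnerProductSpace ℝ V]
    (F : V →L[ℝ] V →L[ℝ] ℝ) : ∃ C : ℝ, 0 ≤ C ∧ ∀ x y, |F x y| ≤ C * ‖x‖ * ‖y‖ :=
  ⟨‖F‖, norm_nonneg F, F.le_opNorm₂⟩

theorem inner_toLpLin {p q : ℕ} (M : Matrix (Fin p) (Fin q) ℝ) (x : EuclideanSpace ℝ (Fin p))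
    (y : EuclideanSpace ℝ (Fin q)) :
    ⟪x, Matrix.toLpLin 2 2 M y⟫_ℝ = ∑ i, ∑ j, x i * M i j * y j := by
  rw [PiLp.inner_apply]
  refine Finset.sum_congr rfl fun i _ => ?_
  simp only [Matrix.toLpLin_apply, Matrix.mulVec, dotProduct, RCLike.inner_apply, conj_trivial]
  rw [Finset.sum_mul]
  exact Finset.sum_congr rfl fun j _ => by ring

/-! ### Singular values of the leading blocks and of the representation -/

section Representation

variable {𝓛 : Submodule ℝ L2Controls} {L : ℕ∞} (F : 𝓛 →L[ℝ] 𝓛 →L[ℝ] ℝ)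
  (e f : HilbertBasis (BasisIndex L) ℝ 𝓛)

theorem entry_matrixRep (i j : ℕ) :
    entry (matrixRep F e f) i j = F (paddedBasis e i) (paddedBasis f j) := by
  unfold entry
  split_ifs with h
  · rw [paddedBasis_of_lt e h.1, paddedBasis_of_lt f h.2]
    rfl
  · rcases not_and_or.mp h with h | h
    · rw [paddedBasis_of_not_lt e h]
      simp
    · rw [paddedBasis_of_not_lt f h]
      simp

theorem leadingBlock_matrixRep (l : ℕ) (i j : Fin l) :
    leadingBlock (matrixRep F e f) l i j = F (paddedBasis e i) (paddedBasis f j) :=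
  entry_matrixRep F e f i j

theorem inner_leadingBlock (l : ℕ) (ξ η : EuclideanSpace ℝ (Fin l)) :
    ⟪ξ, Matrix.toLpLin 2 2 (leadingBlock (matrixRep F e f) l) η⟫_ℝ =
      F (∑ i, ξ i • paddedBasis e i) (∑ j, η j • paddedBasis f j) := by
  rw [inner_toLpLin]
  simp only [map_sum, map_smul, sum_apply, smul_apply, smul_eq_mul, leadingBlock_matrixRep,
    Finset.mul_sum]
  rw [Finset.sum_comm]
  exact Finset.sum_congr rfl fun j _ => Finset.sum_congr rfl fun i _ => by ring

variable {F e f}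

/-- Min-max for the block, tested on the coordinates of combinations of `y` paired with those of
`x`. Truncation perturbs the diagonal form by the subtracted error, which tends to `0` as `l` grows
and vanishes once `l` reaches a finite `L`. -/
theorem le_singularValue_leadingBlock {k : ℕ} {x y : Fin (k + 1) → 𝓛} (hx : Orthonormal ℝ x)
    (hy : Orthonormal ℝ y) {c : ℝ} {b : Fin (k + 1) → ℝ} (hb : ∀ i, c ≤ b i)
    (hxy : ∀ i j, F (x i) (y j) = if i = j then b j else 0) (l : ℕ) :
    c - ∑ i, ∑ j, |F (truncation e l (x i)) (truncation f l (y j)) - F (x i) (y j)| ≤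
      singularValue (leadingBlock (matrixRep F e f) l) k := by
  set δ : Fin (k + 1) → Fin (k + 1) → ℝ := fun i j =>
    F (truncation e l (x i)) (truncation f l (y j)) - F (x i) (y j) with hδ
  have hcomb : ∀ {z : Fin (k + 1) → 𝓛} (_ : Orthonormal ℝ z) (a : EuclideanSpace ℝ (Fin (k + 1))),
      ‖∑ i, a i • z i‖ = ‖a‖ := fun {z} hz a => by
    rw [← sq_eq_sq₀ (norm_nonneg _) (norm_nonneg _), EuclideanSpace.norm_sq_eq,
      ← real_inner_self_eq_norm_sq, hz.inner_sum]
    exact Finset.sum_congr rfl fun i _ => by simp [sq]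
  let g : EuclideanSpace ℝ (Fin (k + 1)) →ₗ[ℝ] EuclideanSpace ℝ (Fin l) :=
    coordinates f l ∘ₗ
      (Fintype.linearCombination ℝ y ∘ₗ (WithLp.linearEquiv 2 ℝ (Fin (k + 1) → ℝ)).toLinearMap)
  have hg : ∀ a, g a = coordinates f l (∑ i, a i • y i) := fun a => rfl
  refine LinearMap.le_singularValues_of_le_norm _ g (fun a => ?_) fun a => ?_
  · rw [hg, ← hcomb hy a]
    exact norm_coordinates_le _ _ _
  rcases eq_or_ne a 0 with rfl | ha
  · simp
  have hpos : 0 < ‖a‖ := norm_pos_iff.mpr ha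
  have h1 : ⟪coordinates e l (∑ i, a i • x i),
      Matrix.toLpLin 2 2 (leadingBlock (matrixRep F e f) l) (g a)⟫_ℝ =
      ∑ i, ∑ j, a i * a j * (F (x i) (y j) + δ i j) := by
    rw [inner_leadingBlock, hg, sum_coordinates_smul, sum_coordinates_smul]
    simp only [map_sum, map_smul, sum_apply, smul_apply, smul_eq_mul, hδ, Finset.mul_sum]
    rw [Finset.sum_comm]
    exact Finset.sum_congr rfl fun j _ => Finset.sum_congr rfl fun i _ => by ring
  have h2 : c * ‖a‖ ^ 2 ≤ ∑ i, ∑ j, a i * a j * F (x i) (y j) := by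
    rw [EuclideanSpace.norm_sq_eq, Finset.mul_sum]
    refine Finset.sum_le_sum fun i _ => ?_
    simp only [hxy, mul_ite, mul_zero, Finset.sum_ite_eq, Finset.mem_univ, if_true,
      Real.norm_eq_abs, sq_abs]
    nlinarith [hb i, mul_self_nonneg (a i)]
  -- The crude bound `|a i| |a j| ≤ ‖a‖ ^ 2` is enough.
  have h3 : -((∑ i, ∑ j, |δ i j|) * ‖a‖ ^ 2) ≤ ∑ i, ∑ j, a i * a j * δ i j := by
    have hcoord : ∀ i, |a i| ≤ ‖a‖ := fun i => PiLp.norm_apply_le a i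
    rw [Finset.sum_mul, ← Finset.sum_neg_distrib]
    refine Finset.sum_le_sum fun i _ => ?_
    rw [Finset.sum_mul, ← Finset.sum_neg_distrib]
    refine Finset.sum_le_sum fun j _ => (abs_le.mp ?_).1
    rw [abs_mul, abs_mul, mul_comm, sq]
    exact mul_le_mul_of_nonneg_left
      (mul_le_mul (hcoord i) (hcoord j) (abs_nonneg _) (norm_nonneg _)) (abs_nonneg _)
  have h4 : (c - ∑ i, ∑ j, |δ i j|) * ‖a‖ ^ 2 ≤
      ‖a‖ * ‖Matrix.toLpLin 2 2 (leadingBlock (matrixRep F e f) l) (g a)‖ := by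
    calc _ ≤ ∑ i, ∑ j, a i * a j * (F (x i) (y j) + δ i j) := by
          simp only [mul_add, Finset.sum_add_distrib]
          linarith
      _ ≤ _ := by
          rw [← h1]
          refine (real_inner_le_norm _ _).trans ?_
          refine mul_le_mul_of_nonneg_right ?_ (norm_nonneg _)
          rw [← hcomb hx a]
          exact norm_coordinates_le _ _ _
  refine le_of_mul_le_mul_left ?_ hpos
  calc _ = (c - ∑ i, ∑ j, |δ i j|) * ‖a‖ ^ 2 := by ring
    _ ≤ _ := h4

theorem tendsto_truncation_error {k : ℕ} (x y : Fin k → 𝓛) :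
    Tendsto (fun l => ∑ i, ∑ j,
      |F (truncation e l (x i)) (truncation f l (y j)) - F (x i) (y j)|) atTop (𝓝 0) := by
  have h0 : (∑ i : Fin k, ∑ j : Fin k, |F (x i) (y j) - F (x i) (y j)|) = 0 := by simp
  refine le_trans ?_ (le_of_eq (congrArg 𝓝 h0))
  refine tendsto_finsetSum _ fun i _ => tendsto_finsetSum _ fun j _ => ?_
  exact ((tendsto_bilinear_apply F (tendsto_truncation e (x i)) (tendsto_truncation f (y j))).sub tendsto_const_nhds).abs

/-- The singular vectors of a leading block, as elements of the control space. -/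
theorem exists_orthonormal_leadingBlock (F : 𝓛 →L[ℝ] 𝓛 →L[ℝ] ℝ)
    (e f : HilbertBasis (BasisIndex L) ℝ 𝓛) {l : ℕ} (hl : (l : ℕ∞) ≤ L) :
    ∃ x y : Fin l → 𝓛, Orthonormal ℝ x ∧ Orthonormal ℝ y ∧ ∀ i j, F (x i) (y j) =
      if i = j then singularValue (leadingBlock (matrixRep F e f) l) j else 0 := by
  obtain ⟨u, v, huv⟩ := (Matrix.toLpLin 2 2
    (leadingBlock (matrixRep F e f) l)).exists_singularBases (p := l) (q := l) (by simp) (by simp)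
  have key : ∀ (b : HilbertBasis (BasisIndex L) ℝ 𝓛)
      (w : OrthonormalBasis (Fin l) ℝ (EuclideanSpace ℝ (Fin l))),
      Orthonormal ℝ fun i => ∑ j, w i j • paddedBasis b j := fun b w => by
    rw [orthonormal_iff_ite]
    intro i j
    rw [(orthonormal_paddedBasis b hl).inner_sum, ← orthonormal_iff_ite.mp w.orthonormal,
      PiLp.inner_apply]
    exact Finset.sum_congr rfl fun k _ => by simp [mul_comm]
  refine ⟨_, _, key e u, key f v, fun i j => ?_⟩
  rw [← inner_leadingBlock, huv]
  simp [Fin.ext_iff, singularValue]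

theorem bddAbove_singularValue (hL : L = ⊤) (k : ℕ) :
    BddAbove (Set.range fun l => singularValue (leadingBlock (matrixRep F e f) l) k) := by
  obtain ⟨C, hC, hF⟩ := exists_bilinear_bound F
  refine ⟨C, ?_⟩
  rintro _ ⟨l, rfl⟩
  dsimp only
  rcases le_or_gt l k with h | h
  · rw [singularValue, LinearMap.singularValues_of_finrank_le _ (by simpa using h)]
    exact hC
  obtain ⟨x, y, hx, hy, hxy⟩ := exists_orthonormal_leadingBlock F e f (l := l) (by simp [hL])
  have h1 := hxy ⟨k, h⟩ ⟨k, h⟩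
  rw [if_pos rfl] at h1
  dsimp only at h1
  rw [← h1]
  refine (le_abs_self _).trans ((hF _ _).trans ?_)
  rw [hx.norm_eq_one, hy.norm_eq_one]
  simp

/-- Shows that the limit in `repSingularValue` is a genuine one: it is the supremum over all blocks.
The singular vectors of one block are test vectors for every other, with an error that tends to `0`.
-/
theorem tendsto_singularValue_leadingBlock (hL : L = ⊤) (k : ℕ) :
    Tendsto (fun l => singularValue (leadingBlock (matrixRep F e f) l) k) atTop
      (𝓝 (repSingularValue (matrixRep F e f) k)) := by
  suffices h : Tendsto (fun l => singularValue (leadingBlock (matrixRep F e f) l) k) atTop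
      (𝓝 (⨆ l, singularValue (leadingBlock (matrixRep F e f) l) k)) by
    rw [repSingularValue, if_pos hL]
    exact tendsto_nhds_limUnder ⟨_, h⟩
  have hbdd := bddAbove_singularValue (F := F) (e := e) (f := f) hL k
  refine tendsto_order.mpr ⟨fun c hc => ?_, fun c hc => ?_⟩
  · obtain ⟨l₀, hl₀⟩ := exists_lt_of_lt_ciSup hc
    rcases le_or_gt l₀ k with h | h
    · rw [singularValue, LinearMap.singularValues_of_finrank_le _ (by simpa using h)] at hl₀
      exact Eventually.of_forall fun l => hl₀.trans_le (LinearMap.singularValues_nonneg _ _)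
    obtain ⟨x, y, hx, hy, hxy⟩ := exists_orthonormal_leadingBlock F e f (l := l₀) (by simp [hL])
    have hinj : Function.Injective (Fin.castLE h) := Fin.castLE_injective h
    have hle := le_singularValue_leadingBlock (e := e) (f := f) (F := F)
      (hx.comp _ hinj) (hy.comp _ hinj)
      (b := fun i : Fin (k + 1) => singularValue (leadingBlock (matrixRep F e f) l₀) i)
      (c := singularValue (leadingBlock (matrixRep F e f) l₀) k)
      (fun i => LinearMap.singularValues_antitone _ (by omega))
      (fun i j => by simp [hxy])
    have ht := (tendsto_truncation_error (F := F) (e := e) (f := f) (x ∘ Fin.castLE h)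
      (y ∘ Fin.castLE h)).const_sub (singularValue (leadingBlock (matrixRep F e f) l₀) k)
    rw [sub_zero] at ht
    filter_upwards [(tendsto_order.mp ht).1 c hl₀] with l hl
    exact hl.trans_le (hle l)
  · exact Eventually.of_forall fun l => (le_ciSup hbdd l).trans_lt hc

/-- The only property of `σ_k(F)` that the lower bound on the cost uses. -/
theorem le_repSingularValue {k : ℕ} {x y : Fin (k + 1) → 𝓛} (hx : Orthonormal ℝ x)
    (hy : Orthonormal ℝ y) {c : ℝ} {b : Fin (k + 1) → ℝ} (hb : ∀ i, c ≤ b i)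
    (hxy : ∀ i j, F (x i) (y j) = if i = j then b j else 0) :
    c ≤ repSingularValue (matrixRep F e f) k := by
  by_cases hL : L = ⊤
  · have ht := (tendsto_truncation_error (F := F) (e := e) (f := f) x y).const_sub c
    rw [sub_zero] at ht
    exact le_of_tendsto_of_tendsto' ht (tendsto_singularValue_leadingBlock hL k)
      (le_singularValue_leadingBlock hx hy hb hxy)
  · have h := le_singularValue_leadingBlock (e := e) (f := f) hx hy hb hxy L.toNat
    have hLe : L ≤ (L.toNat : ℕ∞) := (ENat.natCast_toNat hL).ge
    simp only [truncation_eq_self _ hLe, sub_self, abs_zero, Finset.sum_const_zero, sub_zero] at h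
    rwa [repSingularValue, if_neg hL]

theorem singularValue_leadingBlock_le {l k : ℕ} (hl : (l : ℕ∞) ≤ L) (hk : k < l) :
    singularValue (leadingBlock (matrixRep F e f) l) k ≤ repSingularValue (matrixRep F e f) k := by
  obtain ⟨x, y, hx, hy, hxy⟩ := exists_orthonormal_leadingBlock F e f hl
  have hinj : Function.Injective (Fin.castLE hk) := Fin.castLE_injective hk
  exact le_repSingularValue (hx.comp _ hinj) (hy.comp _ hinj)
    (b := fun i : Fin (k + 1) => singularValue (leadingBlock (matrixRep F e f) l) i)
    (fun i => LinearMap.singularValues_antitone _ (by omega)) (fun i j => by simp [hxy])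

/-- A block larger than the dimension contains a zero row from the padding. -/
theorem le_dim_of_det_leadingBlock_ne_zero {l : ℕ}
    (h : (leadingBlock (matrixRep F e f) l).det ≠ 0) : (l : ℕ∞) ≤ L := by
  by_contra hl
  rw [not_le] at hl
  obtain ⟨N, rfl⟩ := ENat.ne_top_iff_exists.mp hl.ne_top
  have hN : N < l := by exact_mod_cast hl
  refine h (Matrix.det_eq_zero_of_row_eq_zero ⟨N, hN⟩ fun j => ?_)
  rw [leadingBlock_matrixRep, paddedBasis_of_not_lt e (by simp)]
  simp

theorem singularValue_pos_of_det_ne_zero {l : ℕ} {M : Matrix (Fin l) (Fin l) ℝ} (h : M.det ≠ 0)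
    {k : ℕ} (hk : k < l) : 0 < singularValue M k := by
  refine (LinearMap.injective_iff_forall_lt_finrank_singularValues_pos _).mp ?_ k (by simpa using hk)
  intro a b hab
  have h1 := congrArg WithLp.ofLp hab
  simp only [Matrix.toLpLin_apply] at h1
  exact WithLp.ofLp_injective 2 (Matrix.mulVec_injective_of_isUnit
    ((Matrix.isUnit_iff_isUnit_det M).mpr (isUnit_iff_ne_zero.mpr h)) h1)

end Representation

end BilinearControl

/-! ### The upper min-max bound and Abel summation -/

open Module InnerProductSpace

/-- The other half of Courant-Fischer: the span of the first `k + 1` right singular vectors meets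
the kernel of `φ`, and there `T` stretches by at least `σ_k`. -/
theorem LinearMap.singularValues_le_of_norm_le {E E' : Type*} [NormedAddCommGroup E]
    [InnerProductSpace ℝ E] [FiniteDimensional ℝ E] [NormedAddCommGroup E']
    [InnerProductSpace ℝ E'] [FiniteDimensional ℝ E'] (T : E →ₗ[ℝ] E') {k : ℕ} {c : ℝ}
    (hc : 0 ≤ c) (φ : E →ₗ[ℝ] (Fin k → ℝ)) (hφ : ∀ w, φ w = 0 → ‖T w‖ ≤ c * ‖w‖) :
    T.singularValues k ≤ c := by
  rcases le_or_gt (finrank ℝ E) k with hk | hk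
  · rwa [T.singularValues_of_finrank_le hk]
  obtain ⟨v, hv⟩ := T.exists_rightSingularBasis rfl
  let ι : Fin (k + 1) → Fin (finrank ℝ E) := Fin.castLE hk
  have hι : Function.Injective ι := Fin.castLE_injective hk
  let g : (Fin (k + 1) → ℝ) →ₗ[ℝ] E := Fintype.linearCombination ℝ (v ∘ ι)
  have hg : ∀ a, g a = ∑ i, a i • v (ι i) := fun a => rfl
  obtain ⟨a, ha, ha0⟩ : ∃ a, φ (g a) = 0 ∧ a ≠ 0 := by
    have := LinearMap.ker_ne_bot_of_finrank_lt (f := φ ∘ₗ g) (by simp)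
    obtain ⟨a, h1, h2⟩ := (Submodule.ne_bot_iff _).mp this
    exact ⟨a, h1, h2⟩
  have hnorm : ‖g a‖ ^ 2 = ∑ i, a i ^ 2 := by
    have hvι : Orthonormal ℝ fun i => v (ι i) := v.orthonormal.comp ι hι
    rw [← real_inner_self_eq_norm_sq, hg, hvι.inner_sum]
    exact Finset.sum_congr rfl fun i _ => by simp [sq]
  have hTnorm : ‖T (g a)‖ ^ 2 = ∑ i, a i ^ 2 * T.singularValues (i : Fin (k + 1)) ^ 2 := by
    rw [← real_inner_self_eq_norm_sq, hg]
    simp only [map_sum, map_smul, sum_inner, inner_sum, real_inner_smul_left,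
      real_inner_smul_right, hv, hι.eq_iff]
    refine Finset.sum_congr rfl fun i _ => ?_
    simp [ι]
    ring
  have hpos : 0 < ‖g a‖ := by
    rw [norm_pos_iff]
    intro h
    rw [h, norm_zero, zero_pow two_ne_zero] at hnorm
    have := (Finset.sum_eq_zero_iff_of_nonneg fun i _ => sq_nonneg (a i)).mp hnorm.symm
    exact ha0 (funext fun i => by simpa using this i (Finset.mem_univ i))
  refine le_of_mul_le_mul_right (le_trans ?_ (hφ _ ha)) hpos
  refine le_of_sq_le_sq ?_ (norm_nonneg _)
  rw [mul_pow, hnorm, hTnorm, Finset.mul_sum]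
  refine Finset.sum_le_sum fun i _ => ?_
  rw [mul_comm]
  have := T.singularValues_antitone (show (i : ℕ) ≤ k by omega)
  have := T.singularValues_nonneg k
  gcongr

/-- Abel summation. Partial sums of `d` matter only while `h r > 0`, which is where the dual systems
can be normalized. -/
theorem sum_mul_nonneg_of_antitone {h d : ℕ → ℝ} (hh : Antitone h) (h0 : ∀ k, 0 ≤ h k) {p : ℕ}
    (hd : ∀ r < p, 0 < h r → 0 ≤ ∑ k ∈ Finset.range (r + 1), d k) :
    0 ≤ ∑ k ∈ Finset.range p, h k * d k := by
  -- The second conjunct strengthens the induction: passing from `h r` to the smaller `h (r + 1)`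
  -- preserves it when the partial sum of `d` is nonnegative.
  suffices H : ∀ r ≤ p, 0 ≤ ∑ k ∈ Finset.range r, h k * d k ∧
      h r * ∑ k ∈ Finset.range r, d k ≤ ∑ k ∈ Finset.range r, h k * d k from (H p le_rfl).1
  intro r
  induction r with
  | zero => simp
  | succ r ih =>
    intro hr
    have h1 : h r * ∑ k ∈ Finset.range (r + 1), d k ≤
        ∑ k ∈ Finset.range (r + 1), h k * d k := by
      rw [Finset.sum_range_succ, Finset.sum_range_succ, mul_add]
      linarith [(ih (by omega)).2]
    have hle := hh (Nat.le_succ r)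
    rcases (h0 r).eq_or_lt with hz | hpos
    · have h2 : h (r + 1) = 0 := le_antisymm (hz ▸ hle) (h0 _)
      rw [h2, zero_mul]
      rw [← hz, zero_mul] at h1
      exact ⟨h1, h1⟩
    · have h2 := hd r (by omega) hpos
      exact ⟨(mul_nonneg hpos.le h2).trans h1, (mul_le_mul_of_nonneg_right hle h2).trans h1⟩

/-! ### Cost bounds for controls in an abstract inner product space -/

namespace BilinearControl

/-- Singular value decomposition of a matrix, with the singular vectors indexed by `ℕ`. -/
theorem exists_matrix_svd {m n : ℕ} (H : Matrix (Fin m) (Fin n) ℝ) :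
    ∃ (P : ℕ → Fin m → ℝ) (Q : ℕ → Fin n → ℝ),
      (∀ a < m, ∑ i, P a i ^ 2 = 1) ∧ (∀ b < n, ∑ j, Q b j ^ 2 = 1) ∧
      (∀ i i', ∑ a ∈ Finset.range m, P a i * P a i' = if i = i' then 1 else 0) ∧
      (∀ j j', ∑ b ∈ Finset.range n, Q b j * Q b j' = if j = j' then 1 else 0) ∧
      (∀ a < m, ∀ b < n, ∑ i, ∑ j, P a i * H i j * Q b j =
        if a = b then singularValue H b else 0) ∧
      ∀ i j, H i j = ∑ k ∈ Finset.range (min m n), singularValue H k * P k i * Q k j := by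
  obtain ⟨p, q, hpq⟩ := (Matrix.toLpLin 2 2 H).exists_singularBases (p := m) (q := n)
    (by simp) (by simp)
  have hnorm : ∀ {l : ℕ} (w : OrthonormalBasis (Fin l) ℝ (EuclideanSpace ℝ (Fin l))) (a : Fin l),
      ∑ i, w a i ^ 2 = 1 := fun w a => by
    have := w.orthonormal.norm_eq_one a
    rw [EuclideanSpace.norm_eq, Real.sqrt_eq_one] at this
    simpa using this
  have hcomp : ∀ {l : ℕ} (w : OrthonormalBasis (Fin l) ℝ (EuclideanSpace ℝ (Fin l))) (i i' : Fin l),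
      ∑ a, w a i * w a i' = if i = i' then 1 else 0 := fun w i i' => by
    have := w.sum_inner_mul_inner (EuclideanSpace.single i 1) (EuclideanSpace.single i' 1)
    simpa [EuclideanSpace.inner_single_left, EuclideanSpace.inner_single_right,
      Pi.single_apply, eq_comm] using this
  have hH : ∀ a b, ∑ i, ∑ j, p a i * H i j * q b j =
      if (a : ℕ) = b then singularValue H b else 0 := fun a b => by
    rw [← inner_toLpLin, hpq]
    rfl
  refine ⟨fun a i => if h : a < m then p ⟨a, h⟩ i else 0,
    fun b j => if h : b < n then q ⟨b, h⟩ j else 0, fun a ha => ?_, fun b hb => ?_,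
    fun i i' => ?_, fun j j' => ?_, fun a ha b hb => ?_, fun i j => ?_⟩
  · simpa [ha] using hnorm p ⟨a, ha⟩
  · simpa [hb] using hnorm q ⟨b, hb⟩
  · rw [Finset.sum_range, ← hcomp p]
    simp
  · rw [Finset.sum_range, ← hcomp q]
    simp
  · simpa [ha, hb] using hH ⟨a, ha⟩ ⟨b, hb⟩
  · have h1 : H i j = ∑ a, ∑ b, p a i * q b j *
        (if (a : ℕ) = b then singularValue H b else 0) := by
      simp only [← hH, Finset.mul_sum]
      -- Both completeness relations are inserted around `H`; regrouping the fourfold sum leaves its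
      -- coefficients in the singular bases.
      have h2 : H i j = ∑ i', ∑ j', (∑ a, p a i * p a i') * (∑ b, q b j * q b j') * H i' j' := by
        simp [hcomp]
      rw [h2]
      simp only [Finset.sum_mul, Finset.mul_sum]
      simp only [← Finset.sum_product', Finset.univ_product_univ]
      refine Fintype.sum_equiv
        ⟨fun z => (z.2.2.2, z.2.2.1, z.1, z.2.1), fun z => (z.2.2.1, z.2.2.2, z.2.1, z.1),
          fun _ => rfl, fun _ => rfl⟩ _ _ fun z => ?_
      simp
      ring
    rw [h1]
    have h3 : ∀ g : ℕ → ℕ → ℝ, ∑ a ∈ Finset.range m, ∑ b ∈ Finset.range n,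
        (if a = b then g a b else 0) = ∑ k ∈ Finset.range (min m n), g k k := fun g => by
      simp only [Finset.sum_ite_eq]
      rw [← Finset.sum_filter]
      refine Finset.sum_congr ?_ fun _ _ => rfl
      ext k
      simp
    have h4 := h3 fun a b => (if h : a < m then p ⟨a, h⟩ i else 0) *
      (if h : b < n then q ⟨b, h⟩ j else 0) * singularValue H b
    rw [Finset.sum_range] at h4
    simp only [Finset.sum_range (n := n), Fin.is_lt, dif_pos] at h4
    simp only [mul_ite, mul_zero]
    refine h4.trans (Finset.sum_congr rfl fun k _ => by ring)

section Controls

variable {V : Type*} [NormedAddCommGroup V] [InnerProductSpace ℝ V] {m n : ℕ}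

theorem sum_norm_sq_rotation {P : ℕ → Fin m → ℝ}
    (hP : ∀ i i', ∑ a ∈ Finset.range m, P a i * P a i' = if i = i' then 1 else 0)
    (u : Fin m → V) :
    ∑ a ∈ Finset.range m, ‖∑ i, P a i • u i‖ ^ 2 = ∑ i, ‖u i‖ ^ 2 := by
  simp only [← real_inner_self_eq_norm_sq, sum_inner, inner_sum, real_inner_smul_left,
    real_inner_smul_right]
  rw [Finset.sum_comm]
  refine Finset.sum_congr rfl fun i _ => ?_
  rw [Finset.sum_comm]
  have : ∀ j, ∑ a ∈ Finset.range m, P a i * (P a j * ⟪u i, u j⟫_ℝ) =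
      if i = j then ⟪u i, u j⟫_ℝ else 0 := fun j => by
    simp only [← mul_assoc]
    rw [← Finset.sum_mul, hP]
    simp
  refine (Finset.sum_congr rfl fun j _ => ?_).trans
    (Fintype.sum_ite_eq i fun j => ⟪u i, u j⟫_ℝ)
  rw [← this]
  exact Finset.sum_congr rfl fun a _ => by rw [real_inner_comm]

/-- `τ` stands for the singular values of `F`, known only through their min-max property. -/
theorem sum_singularValue_div_le_cost (F : V →L[ℝ] V →L[ℝ] ℝ) (hm : 0 < m) (hn : 0 < n)
    {H : Matrix (Fin m) (Fin n) ℝ} {u : Fin m → V} {v : Fin n → V}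
    (huv : ∀ i j, F (u i) (v j) = H i j) {τ : ℕ → ℝ}
    (hτ : ∀ (k : ℕ) (x y : Fin (k + 1) → V) (b : Fin (k + 1) → ℝ) (c : ℝ), Orthonormal ℝ x →
      Orthonormal ℝ y → (∀ i, c ≤ b i) → (∀ i j, F (x i) (y j) = if i = j then b j else 0) →
      c ≤ τ k) :
    2 / √((m : ℝ) * n) * ∑ k ∈ Finset.range (min m n), singularValue H k / τ k ≤
      1 / (m : ℝ) * ∑ i, ‖u i‖ ^ 2 + 1 / (n : ℝ) * ∑ j, ‖v j‖ ^ 2 := by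
  obtain ⟨P, Q, -, -, hP, hQ, hPQ, -⟩ := exists_matrix_svd H
  let U : ℕ → V := fun a => ∑ i, P a i • u i
  let W : ℕ → V := fun b => ∑ j, Q b j • v j
  have hUW : ∀ a < m, ∀ b < n, F (U a) (W b) = if a = b then singularValue H b else 0 :=
      fun a ha b hb => by
    rw [← hPQ a ha b hb]
    simp only [U, W, map_sum, map_smul, sum_apply, smul_apply, smul_eq_mul, huv, Finset.mul_sum]
    rw [Finset.sum_comm]
    exact Finset.sum_congr rfl fun i _ => Finset.sum_congr rfl fun j _ => by ring
  have h0 : ∀ k, 0 ≤ singularValue H k := fun k => LinearMap.singularValues_nonneg _ k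
  have hanti : Antitone (singularValue H) := LinearMap.singularValues_antitone _
  -- `d k` is the excess of the normalized product `‖U k‖‖W k‖/σ_k(H)` over `1/τ k`. Its partial
  -- sums are nonnegative by the trace bound for the dual systems.
  have key := sum_mul_nonneg_of_antitone hanti h0 (p := min m n)
    (d := fun k => ‖U k‖ * ‖W k‖ / singularValue H k - (τ k)⁻¹) fun r hr hpos => by
      have hσ : ∀ k : Fin (r + 1), 0 < singularValue H k := fun k =>
        hpos.trans_le (hanti (by omega))
      obtain ⟨x, y, b, hx, hy, hb, hbpos, hxy, hsum⟩ := exists_sum_inv_le_of_dual F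
        (fun k : Fin (r + 1) => U k) (fun k => (singularValue H k)⁻¹ • W k) fun i j => by
          rw [map_smul, hUW i (by omega) j (by omega), smul_eq_mul]
          have := (hσ j).ne'
          by_cases hij : i = j
          · simp [hij, this]
          · simp [hij, Fin.ext_iff.not.mp hij]
      rw [Finset.sum_sub_distrib, sub_nonneg, Finset.sum_range, Finset.sum_range]
      calc ∑ k : Fin (r + 1), (τ k)⁻¹ ≤ ∑ k : Fin (r + 1), (b k)⁻¹ := by
            refine Finset.sum_le_sum fun k _ => inv_anti₀ (hbpos k) ?_
            have hk : (k : ℕ) + 1 ≤ r + 1 := by omega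
            have hinj : Function.Injective (Fin.castLE hk) := Fin.castLE_injective hk
            exact hτ k _ _ (fun i => b i) _ (hx.comp _ hinj) (hy.comp _ hinj)
              (fun i => hb (by omega)) fun i j => by simp [hxy]
        _ ≤ _ := hsum
        _ = _ := by
          refine Finset.sum_congr rfl fun k _ => ?_
          rw [norm_smul, Real.norm_of_nonneg (inv_nonneg.mpr (h0 k))]
          ring
  have h1 : ∑ k ∈ Finset.range (min m n), singularValue H k / τ k ≤
      ∑ k ∈ Finset.range (min m n), ‖U k‖ * ‖W k‖ := by
    rw [← sub_nonneg, ← Finset.sum_sub_distrib]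
    refine key.trans (Finset.sum_le_sum fun k _ => ?_)
    rw [mul_sub, ← div_eq_mul_inv]
    refine sub_le_sub_right ?_ _
    rcases (h0 k).eq_or_lt with h | h
    · rw [← h, zero_mul]
      positivity
    · rw [mul_div_cancel₀ _ h.ne']
  have hm' : (0 : ℝ) < m := by exact_mod_cast hm
  have hn' : (0 : ℝ) < n := by exact_mod_cast hn
  have h2 : ∀ a b : ℝ, 2 / √((m : ℝ) * n) * (a * b) ≤ 1 / (m : ℝ) * a ^ 2 + 1 / (n : ℝ) * b ^ 2 :=
      fun a b => by
    have h3 := sq_nonneg (a / √m - b / √n)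
    have h4 : (a / √m - b / √n) ^ 2 =
        a ^ 2 / √m ^ 2 + b ^ 2 / √n ^ 2 - 2 / (√m * √n) * (a * b) := by
      have := (Real.sqrt_pos.mpr hm').ne'
      have := (Real.sqrt_pos.mpr hn').ne'
      field_simp
      ring
    rw [h4, Real.sq_sqrt hm'.le, Real.sq_sqrt hn'.le, ← Real.sqrt_mul hm'.le] at h3
    rw [one_div_mul_eq_div, one_div_mul_eq_div]
    linarith
  calc _ ≤ 2 / √((m : ℝ) * n) * ∑ k ∈ Finset.range (min m n), ‖U k‖ * ‖W k‖ := by gcongr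
    _ ≤ 1 / (m : ℝ) * ∑ k ∈ Finset.range (min m n), ‖U k‖ ^ 2 +
        1 / (n : ℝ) * ∑ k ∈ Finset.range (min m n), ‖W k‖ ^ 2 := by
      rw [Finset.mul_sum, Finset.mul_sum, Finset.mul_sum, ← Finset.sum_add_distrib]
      exact Finset.sum_le_sum fun k _ => h2 _ _
    _ ≤ 1 / (m : ℝ) * ∑ k ∈ Finset.range m, ‖U k‖ ^ 2 +
        1 / (n : ℝ) * ∑ k ∈ Finset.range n, ‖W k‖ ^ 2 := by
      gcongr
      · exact Nat.min_le_left m n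
      · exact Nat.min_le_right m n
    _ = _ := by rw [sum_norm_sq_rotation hP, sum_norm_sq_rotation hQ]

theorem exists_controls_of_diagonal (F : V →L[ℝ] V →L[ℝ] ℝ) (hm : 0 < m) (hn : 0 < n)
    (H : Matrix (Fin m) (Fin n) ℝ) {x y : Fin (min m n) → V} (hx : Orthonormal ℝ x)
    (hy : Orthonormal ℝ y) {b : ℕ → ℝ} (hb : ∀ k < min m n, 0 < b k)
    (hxy : ∀ i j, F (x i) (y j) = if i = j then b j else 0) :
    ∃ (u : Fin m → V) (v : Fin n → V), (∀ i j, F (u i) (v j) = H i j) ∧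
      1 / (m : ℝ) * ∑ i, ‖u i‖ ^ 2 + 1 / (n : ℝ) * ∑ j, ‖v j‖ ^ 2 =
        2 / √((m : ℝ) * n) * ∑ k ∈ Finset.range (min m n), singularValue H k / b k := by
  obtain ⟨P, Q, hP, hQ, -, -, -, hH⟩ := exists_matrix_svd H
  have hm' : (0 : ℝ) < m := by exact_mod_cast hm
  have hn' : (0 : ℝ) < n := by exact_mod_cast hn
  have hsm := Real.sqrt_pos.mpr hm'
  have hsn := Real.sqrt_pos.mpr hn'
  have h0 : ∀ k, 0 ≤ singularValue H k := fun k => LinearMap.singularValues_nonneg _ k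
  have hbk : ∀ k : Fin (min m n), 0 < b k := fun k => hb k k.2
  -- The weights satisfy `α k * β k = σ_k(H) / b k`, which realizes `H`, and `α k ^ 2 / m = β k ^ 2
  -- / n`, the equality case of AM-GM.
  let α : Fin (min m n) → ℝ := fun k => √(singularValue H k / b k * (√m / √n))
  let β : Fin (min m n) → ℝ := fun k => √(singularValue H k / b k * (√n / √m))
  have hq : ∀ k : Fin (min m n), 0 ≤ singularValue H k / b k := fun k =>
    div_nonneg (h0 k) (hbk k).le
  have hα : ∀ k, α k ^ 2 = singularValue H k / b k * (√m / √n) := fun k =>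
    Real.sq_sqrt (mul_nonneg (hq k) (by positivity))
  have hβ : ∀ k, β k ^ 2 = singularValue H k / b k * (√n / √m) := fun k =>
    Real.sq_sqrt (mul_nonneg (hq k) (by positivity))
  have hαβ : ∀ k, α k * β k = singularValue H k / b k := fun k => by
    rw [← Real.sqrt_mul (mul_nonneg (hq k) (by positivity)), Real.sqrt_eq_iff_mul_self_eq
      (mul_nonneg (mul_nonneg (hq k) (by positivity)) (mul_nonneg (hq k) (by positivity))) (hq k)]
    field_simp
  have hnorm : ∀ {l : ℕ} {R : ℕ → Fin l → ℝ} (_ : ∀ a < l, ∑ i, R a i ^ 2 = 1)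
      (_ : min m n ≤ l) {z : Fin (min m n) → V} (_ : Orthonormal ℝ z) (γ : Fin (min m n) → ℝ),
      ∑ i, ‖∑ k : Fin (min m n), (γ k * R k i) • z k‖ ^ 2 = ∑ k, γ k ^ 2 :=
      fun {l R} hR hl {z} hz γ => by
    have : ∀ i, ‖∑ k : Fin (min m n), (γ k * R k i) • z k‖ ^ 2 =
        ∑ k : Fin (min m n), γ k ^ 2 * R k i ^ 2 := fun i => by
      rw [← real_inner_self_eq_norm_sq, hz.inner_sum]
      refine Finset.sum_congr rfl fun k _ => ?_
      simp
      ring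
    simp only [this]
    rw [Finset.sum_comm]
    refine Finset.sum_congr rfl fun k _ => ?_
    rw [← Finset.mul_sum, hR k (by omega), mul_one]
  refine ⟨fun i => ∑ k : Fin (min m n), (α k * P k i) • x k,
    fun j => ∑ k : Fin (min m n), (β k * Q k j) • y k, fun i j => ?_, ?_⟩
  · rw [hH, Finset.sum_range]
    simp only [map_sum, map_smul, sum_apply, smul_apply, smul_eq_mul, hxy]
    refine Finset.sum_congr rfl fun k _ => ?_
    simp only [mul_ite, mul_zero, Finset.sum_ite_eq', Finset.mem_univ, if_true]
    calc _ = (α k * β k) * b k * P k i * Q k j := by ring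
      _ = _ := by rw [hαβ, div_mul_cancel₀ _ (hbk k).ne']
  · rw [hnorm hP (Nat.min_le_left m n) hx, hnorm hQ (Nat.min_le_right m n) hy, Finset.sum_range,
      Finset.mul_sum, Finset.mul_sum, Finset.mul_sum, ← Finset.sum_add_distrib]
    refine Finset.sum_congr rfl fun k _ => ?_
    rw [hα, hβ, Real.sqrt_mul hm'.le]
    have e1 : √(m : ℝ) / m = 1 / √m := by rw [Real.sqrt_div_self']
    have e2 : √(n : ℝ) / n = 1 / √n := by rw [Real.sqrt_div_self']
    calc _ = singularValue H k / b k * ((√m / m) / √n + (√n / n) / √m) := by ring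
      _ = _ := by
        rw [e1, e2]
        field_simp
        ring

end Controls

end BilinearControl

namespace BilinearControl

open InnerProductSpace

/-! ### Transfer to protocols and their cost -/

section Protocols

variable {𝓛 : Submodule ℝ L2Controls} {L : ℕ∞} {m n : ℕ}

theorem integral_sq_eq_norm_sq (g : L2Controls) :
    ∫ t in Set.Icc (0 : ℝ) 1, (g t) ^ 2 = ‖g‖ ^ 2 := by
  rw [← real_inner_self_eq_norm_sq, L2.inner_def]
  refine integral_congr_ae (Eventually.of_forall fun t => ?_)
  simp [sq]

theorem integral_sq_add_const (g : L2Controls) (c : ℝ) :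
    ∫ t in Set.Icc (0 : ℝ) 1, ((g t) ^ 2 + c) = ‖g‖ ^ 2 + c := by
  rw [integral_add (Lp.memLp g).integrable_sq (integrable_const c), integral_sq_eq_norm_sq]
  simp

/-- The integral sign in `SingleRoundProtocol.cost` extends over the second summand, which is
constant in the integration variable; as `[0,1]` has measure one, the cost is the sum of the two
average energies nevertheless. -/
theorem SingleRoundProtocol.cost_eq (P : SingleRoundProtocol 𝓛 m n) (hm : 0 < m) :
    P.cost = 1 / (m : ℝ) * ∑ i, ‖P.u i‖ ^ 2 + 1 / (n : ℝ) * ∑ j, ‖P.v j‖ ^ 2 := by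
  have hm' : (m : ℝ) ≠ 0 := by exact_mod_cast hm.ne'
  simp only [SingleRoundProtocol.cost, integral_sq_eq_norm_sq, integral_sq_add_const,
    Submodule.coe_norm, Finset.sum_add_distrib, Finset.sum_const, Finset.card_univ,
    Fintype.card_fin, nsmul_eq_mul]
  field_simp

theorem le_cost_of_realizes {F : 𝓛 →L[ℝ] 𝓛 →L[ℝ] ℝ} {e f : HilbertBasis (BasisIndex L) ℝ 𝓛}
    (hm : 0 < m) (hn : 0 < n) {H : Matrix (Fin m) (Fin n) ℝ} {P : SingleRoundProtocol 𝓛 m n}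
    (hP : P.Realizes F H) :
    2 / √((m : ℝ) * n) * ∑ k ∈ Finset.range (min m n),
      singularValue H k / repSingularValue (matrixRep F e f) k ≤ P.cost := by
  rw [P.cost_eq hm]
  exact sum_singularValue_div_le_cost F hm hn hP
    fun k x y b c hx hy hb hxy => le_repSingularValue hx hy hb hxy

theorem exists_protocol_of_diagonal (F : 𝓛 →L[ℝ] 𝓛 →L[ℝ] ℝ) (hm : 0 < m) (hn : 0 < n)
    (H : Matrix (Fin m) (Fin n) ℝ) {l : ℕ} (hl : min m n ≤ l) {x y : Fin l → 𝓛}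
    (hx : Orthonormal ℝ x) (hy : Orthonormal ℝ y) {b : ℕ → ℝ} (hb : ∀ k < min m n, 0 < b k)
    (hxy : ∀ i j, F (x i) (y j) = if i = j then b j else 0) :
    ∃ P : SingleRoundProtocol 𝓛 m n, P.Realizes F H ∧
      P.cost = 2 / √((m : ℝ) * n) * ∑ k ∈ Finset.range (min m n), singularValue H k / b k := by
  have hinj : Function.Injective (Fin.castLE hl) := Fin.castLE_injective hl
  obtain ⟨u, v, huv, hcost⟩ := exists_controls_of_diagonal F hm hn H (hx.comp _ hinj)
    (hy.comp _ hinj) hb fun i j => by simp [hxy]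
  refine ⟨⟨u, v⟩, huv, ?_⟩
  rw [SingleRoundProtocol.cost_eq _ hm]
  exact hcost

theorem exists_protocol_leadingBlock (F : 𝓛 →L[ℝ] 𝓛 →L[ℝ] ℝ)
    (e f : HilbertBasis (BasisIndex L) ℝ 𝓛) (hm : 0 < m) (hn : 0 < n)
    (H : Matrix (Fin m) (Fin n) ℝ) {l : ℕ} (hl : min m n ≤ l) (hlL : (l : ℕ∞) ≤ L)
    (hpos : ∀ k < min m n, 0 < singularValue (leadingBlock (matrixRep F e f) l) k) :
    ∃ P : SingleRoundProtocol 𝓛 m n, P.Realizes F H ∧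
      P.cost = 2 / √((m : ℝ) * n) * ∑ k ∈ Finset.range (min m n),
        singularValue H k / singularValue (leadingBlock (matrixRep F e f) l) k := by
  obtain ⟨x, y, hx, hy, hxy⟩ := exists_orthonormal_leadingBlock F e f hlL
  exact exists_protocol_of_diagonal F hm hn H hl hx hy hpos hxy

/-- Both halves of min-max: vectors whose first `k` coordinates vanish give `≤`, and the first `k +
1` basis vectors give `≥`. -/
theorem repSingularValue_of_diagonal {F : 𝓛 →L[ℝ] 𝓛 →L[ℝ] ℝ}
    {e f : HilbertBasis (BasisIndex L) ℝ 𝓛} (hL : L = ⊤) {d : ℕ → ℝ} (hd : Antitone d)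
    (hpos : ∀ k, 0 < d k)
    (hF : ∀ i j : ℕ, F (paddedBasis e i) (paddedBasis f j) = if i = j then d j else 0) (k : ℕ) :
    repSingularValue (matrixRep F e f) k = d k := by
  refine le_antisymm ?_ ?_
  · refine le_of_tendsto (tendsto_singularValue_leadingBlock hL k) ?_
    filter_upwards [eventually_gt_atTop k] with l hl
    refine LinearMap.singularValues_le_of_norm_le _ (hpos k).le
      (LinearMap.pi fun j : Fin k => LinearMap.proj (Fin.castLE hl.le j) ∘ₗ
        (WithLp.linearEquiv 2 ℝ (Fin l → ℝ)).toLinearMap) fun w hw => ?_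
    refine le_of_sq_le_sq ?_ (mul_nonneg (hpos k).le (norm_nonneg _))
    rw [mul_pow, EuclideanSpace.norm_sq_eq, EuclideanSpace.norm_sq_eq, Finset.mul_sum]
    refine Finset.sum_le_sum fun i _ => ?_
    have h1 : (Matrix.toLpLin 2 2 (leadingBlock (matrixRep F e f) l) w) i = d i * w i := by
      simp [Matrix.toLpLin_apply, Matrix.mulVec, dotProduct, leadingBlock_matrixRep, hF,
        ← Fin.ext_iff]
    rw [h1, norm_mul, mul_pow, Real.norm_of_nonneg (hpos i).le]
    rcases lt_or_ge (i : ℕ) k with h | h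
    · have h2 : w i = 0 := congrFun hw ⟨i, h⟩
      simp [h2]
    · have := hd h
      have := hpos i
      gcongr
  · refine le_repSingularValue (orthonormal_paddedBasis e (l := k + 1) (by simp [hL]))
      (orthonormal_paddedBasis f (l := k + 1) (by simp [hL])) (b := fun i => d i)
      (fun i => hd (by omega)) fun i j => ?_
    rw [hF]
    simp [Fin.ext_iff]

end Protocols

end BilinearControl

/-! ### The infimum of the cost and its attainment -/

open BilinearControl in
theorem theorem5p1
    (𝓛 : Submodule ℝ BilinearControl.L2Controls)
    (_h𝓛 : IsClosed (𝓛 : Set BilinearControl.L2Controls))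
    (F : 𝓛 →L[ℝ] 𝓛 →L[ℝ] ℝ)
    (L : ℕ∞) (e f : HilbertBasis (BilinearControl.BasisIndex L) ℝ 𝓛)
    (hreg : BilinearControl.IsRegular (BilinearControl.matrixRep F e f))
    (s : ℕ∞) (hs : (BilinearControl.matrixRep F e f).eRank = s)
    (m n : ℕ) (hm : 0 < m) (hn : 0 < n)
    (hmn : ((max m n : ℕ) : ℕ∞) ≤ s)
    (H : Matrix (Fin m) (Fin n) ℝ) :
    IsGLB {c : ℝ | ∃ P : BilinearControl.SingleRoundProtocol 𝓛 m n,
        P.Realizes F H ∧ P.cost = c}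
      (2 / √((m : ℝ) * (n : ℝ)) *
        ∑ k ∈ Finset.range (min m n),
          BilinearControl.singularValue H k /
            BilinearControl.repSingularValue (BilinearControl.matrixRep F e f) k) ∧
    (BilinearControl.IsStronglyRegular (BilinearControl.matrixRep F e f) →
      ∃ P : BilinearControl.SingleRoundProtocol 𝓛 m n,
        P.Realizes F H ∧
        P.cost = 2 / √((m : ℝ) * (n : ℝ)) *
          ∑ k ∈ Finset.range (min m n),
            BilinearControl.singularValue H k /
              BilinearControl.repSingularValue (BilinearControl.matrixRep F e f) k) := by
  -- One nonsingular block of size `max m n` yields both `max m n ≤ L` and the positivity of all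
  -- `σ_k(F)` in the formula.
  have hdet := hreg (max m n) (by omega) (hmn.trans hs.ge)
  have hmL : ((max m n : ℕ) : ℕ∞) ≤ L := le_dim_of_det_leadingBlock_ne_zero hdet
  have hτ : ∀ k < min m n, 0 < repSingularValue (matrixRep F e f) k := fun k hk =>
    (singularValue_pos_of_det_ne_zero hdet (by omega)).trans_le
      (singularValue_leadingBlock_le hmL (by omega))
  have hlower : ∀ {P : SingleRoundProtocol 𝓛 m n}, P.Realizes F H →
      2 / √((m : ℝ) * n) * ∑ k ∈ Finset.range (min m n),
        singularValue H k / repSingularValue (matrixRep F e f) k ≤ P.cost :=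
    fun hP => le_cost_of_realizes hm hn hP
  have hfinite : L ≠ ⊤ → ∃ P : SingleRoundProtocol 𝓛 m n, P.Realizes F H ∧
      P.cost = 2 / √((m : ℝ) * n) * ∑ k ∈ Finset.range (min m n),
        singularValue H k / repSingularValue (matrixRep F e f) k := fun hL => by
    have hrep : ∀ k, repSingularValue (matrixRep F e f) k =
        singularValue (leadingBlock (matrixRep F e f) L.toNat) k := fun k => by
      rw [repSingularValue, if_neg hL]
    simp only [hrep] at hτ ⊢
    have hN := ENat.natCast_toNat hL
    have h1 : max m n ≤ L.toNat := by
      rw [← hN] at hmL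
      exact_mod_cast hmL
    exact exists_protocol_leadingBlock F e f hm hn H (by omega) hN.le hτ
  refine ⟨⟨?_, fun c hc => ?_⟩, ?_⟩
  · rintro _ ⟨P, hP, rfl⟩
    exact hlower hP
  · by_cases hL : L = ⊤
    -- Protocols built from the block of size `l` have costs that converge to the claimed infimum,
    -- so no larger lower bound exists.
    · have hlim : Tendsto (fun l => 2 / √((m : ℝ) * n) * ∑ k ∈ Finset.range (min m n),
          singularValue H k / singularValue (leadingBlock (matrixRep F e f) l) k) atTop
          (𝓝 (2 / √((m : ℝ) * n) * ∑ k ∈ Finset.range (min m n),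
            singularValue H k / repSingularValue (matrixRep F e f) k)) :=
        (tendsto_finsetSum _ fun k hk => tendsto_const_nhds.div
          (tendsto_singularValue_leadingBlock hL k)
          (hτ k (Finset.mem_range.mp hk)).ne').const_mul _
      have hev : ∀ᶠ l in atTop, ∀ k ∈ Finset.range (min m n),
          0 < singularValue (leadingBlock (matrixRep F e f) l) k :=
        (Finset.eventually_all _).mpr fun k hk =>
          (tendsto_singularValue_leadingBlock hL k).eventually_const_lt
            (hτ k (Finset.mem_range.mp hk))
      refine ge_of_tendsto hlim ?_
      filter_upwards [hev, eventually_ge_atTop (min m n)] with l hl hml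
      obtain ⟨P, hP, hcost⟩ := exists_protocol_leadingBlock F e f hm hn H hml (by simp [hL])
        fun k hk => hl k (Finset.mem_range.mpr hk)
      exact hc ⟨P, hP, hcost⟩
    · exact hc (hfinite hL)
  · rintro (⟨hL, -⟩ | ⟨hL, hdiag, hent⟩)
    · exact hfinite hL
    · let d : ℕ → ℝ := fun k => entry (matrixRep F e f) k k
      have hd : Antitone d := antitone_nat_of_succ_le fun k => (hent k).2
      -- Positivity is given only at `j + 1`; monotonicity carries it to index `0`.
      have hpos : ∀ k, 0 < d k := fun k => (hent k).1.trans_le (hent k).2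
      have hF : ∀ i j : ℕ, F (paddedBasis e i) (paddedBasis f j) = if i = j then d j else 0 :=
          fun i j => by
        split_ifs with hij
        · rw [hij, ← entry_matrixRep]
        · rw [paddedBasis_of_lt e (by simp [hL]), paddedBasis_of_lt f (by simp [hL])]
          exact hdiag (by simpa using hij)
      simp only [repSingularValue_of_diagonal hL hd hpos hF]
      exact exists_protocol_of_diagonal F hm hn H le_rfl
        (orthonormal_paddedBasis e (by simp [hL])) (orthonormal_paddedBasis f (by simp [hL]))
        (fun k _ => hpos k) fun i j => by
          rw [hF]
          simp [Fin.ext_iff]
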